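/- For linearly ordered sets, all topologies are order topologies. A topological space $X$ is *Valdivia compact* if for some set $\Gamma$ there is a topological embedding $e\colon X\to[0,1]^\Gamma$ such that $e[X]=\operatorname{cl}(e[X]\cap\Sigma(\Gamma))$, where $\Sigma(\Gamma)=\{x\in[0,1]^\Gamma : \{\gamma\in\Gamma : x(\gamma)\neq 0\}\text{ is countable}\}$ and the closure is taken in $[0,1]^\Gamma$. Let $R^{\to}$ be the long ray, i.e. the set of pairs $(\alpha,t)$ with $\alpha<\omega_1$ and $t\in[0,1)$, ordered lexicographically (first by $\alpha$, then by $t$), and let $R^{\to}+1$ be the linearly ordered set obtained by adding a greatest element to $R^{\to}$. Let ${}^{\leftarrow}I^{\to}$ be the linearly ordered set obtained from the reverse of $R^{\to}+1$, followed by $R^{\to}+1$, by identifying the greatest element of the former with the least element of the latter. **Proposition.** 1. $R^{\to}+1$ is Valdivia compact. 2. ${}^{\leftarrow}I^{\to}$ is, up to order isomorphism, the unique linearly ordered set $K$ with a least element $a$, a greatest element $b$ and $(a,b)\neq\emptyset$ such that for every $p\in(a,b)$ the interval $[p,b]$ is order isomorphic to $R^{\to}+1$ and the interval $[a,p]$ is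 order isomorphic to the reverse of $R^{\to}+1$; and ${}^{\leftarrow}I^{\to}$ is Valdivia compact. -/

import Mathlib

open scoped Ordinal

universe u

/-- The `Σ`-product in the Tychonoff cube `[0,1]^Γ`: the points of countable support. -/
def sigmaProduct (Γ : Type u) : Set (Γ → unitInterval) :=
  {x | {γ | x γ ≠ 0}.Countable}

/-- `X` is Valdivia compact: it embeds in some cube `[0,1]^Γ` in such a way that the image is the
closure (in the cube) of its intersection with the `Σ`-product. In particular the image is closed
in the cube, so that `X` is a compact Hausdorff space. -/
def IsValdiviaCompact (X : Type u) [TopologicalSpace X] : Prop :=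
  ∃ (Γ : Type u) (e : X → Γ → unitInterval), Topology.IsEmbedding e ∧
    Set.range e = closure (Set.range e ∩ sigmaProduct Γ)

/-- The long ray: `ω₁` many copies of `[0,1)` put one after another, i.e. the pairs
`(α, t)` with `α < ω₁` and `t ∈ [0,1)`, ordered lexicographically (first by `α`, then by `t`). -/
def LongRay : Type :=
  (ω₁ : Ordinal.{0}).ToType ×ₗ Set.Ico (0 : ℝ) 1

noncomputable instance : LinearOrder LongRay :=
  inferInstanceAs (LinearOrder ((ω₁ : Ordinal.{0}).ToType ×ₗ Set.Ico (0 : ℝ) 1))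

/-- The compactified long ray: the long ray with a greatest element added. -/
def LongRayPlusOne : Type := WithTop LongRay

noncomputable instance : LinearOrder LongRayPlusOne :=
  inferInstanceAs (LinearOrder (WithTop LongRay))

noncomputable instance : TopologicalSpace LongRayPlusOne := Preorder.topology LongRayPlusOne

instance : OrderTopology LongRayPlusOne := ⟨rfl⟩

/-- `K = [a, b]` is a linearly ordered set with an internal point such that, for every internal
point `p`, the interval `[p, b]` is order isomorphic to the compactified long ray and the interval
`[a, p]` is order isomorphic to the reversed compactified long ray. -/
def IsLongInterval (K : Type u) [LinearOrder K] : Prop :=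
  ∃ a b : K, (∀ x, a ≤ x ∧ x ≤ b) ∧ (Set.Ioo a b).Nonempty ∧
    ∀ p ∈ Set.Ioo a b, Nonempty (Set.Icc p b ≃o LongRayPlusOne) ∧
      Nonempty (Set.Icc a p ≃o LongRayPlusOneᵒᵈ)

/-- The long interval: the reversed compactified long ray followed by the compactified long ray,
glued at the least elements of the two long rays (the left copy of the common point is
left out). -/
def LongInterval : Type :=
  {x : LongRayPlusOne // ¬ IsMin x}ᵒᵈ ⊕ₗ LongRayPlusOne

noncomputable instance : LinearOrder LongInterval :=
  inferInstanceAs (LinearOrder ({x : LongRayPlusOne // ¬ IsMin x}ᵒᵈ ⊕ₗ LongRayPlusOne))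

noncomputable instance : TopologicalSpace LongInterval := Preorder.topology LongInterval

instance : OrderTopology LongInterval := ⟨rfl⟩

/-! The cube coordinates of the compactified long ray are indexed by `ω₁`: `coord α` squeezes
everything outside the copy of index `α` to 0 or 1. These maps are continuous and separate points,
and since proper initial segments of `ω₁` are countable, only `⊤` has uncountable support. The other
points are dense, which gives Valdivia compactness.

The order type rests on `nonempty_Icc_orderIso`: each nondegenerate `[x, y]` with `y ≠ ⊤` is a copy
of `[0,1]`. Replacing one such initial piece by another does not change the ray, so in a long
interval the cut may be moved to any internal point. Uniqueness is then gluing: cut both sets at an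
internal point and match the halves. For Valdivia compactness of the long interval, the coordinates
of the two halves are used side by side. -/

/-! ### Gluing order isomorphisms -/

section Glue

variable {M N : Type*} [LinearOrder M] [LinearOrder N]

/-- Order isomorphisms between the lower and the upper parts at given points can be glued. -/
theorem nonempty_orderIso_of_Iic_of_Ici {y : M} {z : N} (f : Set.Iic y ≃o Set.Iic z)
    (g : Set.Ici y ≃o Set.Ici z) : Nonempty (M ≃o N) := by
  classical
  have hf : ((f ⟨y, le_rfl⟩ : Set.Iic z) : N) = z := congrArg Subtype.val (map_top f)
  have hg : ((g ⟨y, le_rfl⟩ : Set.Ici z) : N) = z := congrArg Subtype.val (map_bot g)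
  let F : M → N := fun x => if h : x ≤ y then f ⟨x, h⟩ else g ⟨x, (not_le.1 h).le⟩
  have hF1 : ∀ x (h : x ≤ y), F x = f ⟨x, h⟩ := fun x h => dif_pos h
  have hF2 : ∀ x (h : y ≤ x), F x = g ⟨x, h⟩ := by
    intro x h
    rcases h.eq_or_lt with rfl | h'
    · rw [hF1 y le_rfl, hf, hg]
    · exact dif_neg (not_le.2 h')
  have hmono : StrictMono F := by
    intro a b hab
    rcases le_total b y with hb | hb
    · rw [hF1 a (hab.le.trans hb), hF1 b hb]
      exact f.strictMono (show (⟨a, _⟩ : Set.Iic y) < ⟨b, _⟩ from hab)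
    · rcases le_total y a with ha | ha
      · rw [hF2 a ha, hF2 b hb]
        exact g.strictMono (show (⟨a, _⟩ : Set.Ici y) < ⟨b, _⟩ from hab)
      · rw [hF1 a ha, hF2 b hb]
        have h1 : ((f ⟨a, ha⟩ : Set.Iic z) : N) ≤ z := (f ⟨a, ha⟩).2
        have h2 : z ≤ ((g ⟨b, hb⟩ : Set.Ici z) : N) := (g ⟨b, hb⟩).2
        -- Equality would force both values to be `z`, hence `a = y = b`.
        refine lt_of_le_of_ne (h1.trans h2) fun h => hab.ne ?_
        have h3 : f ⟨a, ha⟩ = f ⟨y, le_rfl⟩ :=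
          Subtype.ext ((le_antisymm h1 (h ▸ h2)).trans hf.symm)
        have h4 : g ⟨b, hb⟩ = g ⟨y, le_rfl⟩ :=
          Subtype.ext ((le_antisymm (h ▸ h1) h2).trans hg.symm)
        have h5 : a = y := congrArg Subtype.val (f.injective h3)
        have h6 : b = y := congrArg Subtype.val (g.injective h4)
        rw [h5, h6]
  refine ⟨hmono.orderIsoOfSurjective F fun w => ?_⟩
  rcases le_total w z with hw | hw
  · exact ⟨f.symm ⟨w, hw⟩, by rw [hF1 _ (f.symm ⟨w, hw⟩).2]; simp⟩
  · exact ⟨g.symm ⟨w, hw⟩, by rw [hF2 _ (g.symm ⟨w, hw⟩).2]; simp⟩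

/-- An order isomorphism restricts to the upper parts at corresponding points. -/
def OrderIso.restrictIci (f : M ≃o N) (x : M) : Set.Ici x ≃o Set.Ici (f x) where
  toEquiv := f.toEquiv.subtypeEquiv fun a => (f.le_iff_le (x := x) (y := a)).symm
  map_rel_iff' := f.le_iff_le

/-- The upper part at `x` of the upper part at `m ≤ x` is the upper part at `x`. -/
def iciIciOrderIso {m : M} (x : Set.Ici m) : Set.Ici x ≃o Set.Ici (x : M) where
  toFun a := ⟨a.1.1, a.2⟩
  invFun a := ⟨⟨a.1, le_trans x.2 a.2⟩, a.2⟩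
  left_inv _ := rfl
  right_inv _ := rfl
  map_rel_iff' := Iff.rfl

/-- The lower part at `x` of the upper part at `m ≤ x` is the interval `[m, x]`. -/
def iicIciOrderIso {m : M} (x : Set.Ici m) : Set.Iic x ≃o Set.Icc m (x : M) where
  toFun a := ⟨a.1.1, a.1.2, a.2⟩
  invFun a := ⟨⟨a.1, a.2.1⟩, a.2.2⟩
  left_inv _ := rfl
  right_inv _ := rfl
  map_rel_iff' := Iff.rfl

/-- The upper part at `x` of the lower part at `m ≥ x` is the interval `[x, m]`. -/
def iciIicOrderIso {m : M} (x : Set.Iic m) : Set.Ici x ≃o Set.Icc (x : M) m where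
  toFun a := ⟨a.1.1, a.2, a.1.2⟩
  invFun a := ⟨⟨a.1, a.2.2⟩, a.2.1⟩
  left_inv _ := rfl
  right_inv _ := rfl
  map_rel_iff' := Iff.rfl

/-- The upper part of the reversed order is the reversed lower part. -/
def iciDualOrderIso (m : M) : Set.Ici (OrderDual.toDual m) ≃o (Set.Iic m)ᵒᵈ where
  toFun a := OrderDual.toDual ⟨OrderDual.ofDual a.1, a.2⟩
  invFun a := ⟨OrderDual.toDual (OrderDual.ofDual a).1, (OrderDual.ofDual a).2⟩
  left_inv _ := rfl
  right_inv _ := rfl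
  map_rel_iff' := Iff.rfl

/-- The lower part of the reversed order is the reversed upper part. -/
def iicDualOrderIso (m : M) : Set.Iic (OrderDual.toDual m) ≃o (Set.Ici m)ᵒᵈ where
  toFun a := OrderDual.toDual ⟨OrderDual.ofDual a.1, a.2⟩
  invFun a := ⟨OrderDual.toDual (OrderDual.ofDual a).1, (OrderDual.ofDual a).2⟩
  left_inv _ := rfl
  right_inv _ := rfl
  map_rel_iff' := Iff.rfl

/-- Reversal of the unit interval. -/
def unitIntervalReversal : unitInterval ≃o unitIntervalᵒᵈ where
  toFun x := OrderDual.toDual (unitInterval.symm x)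
  invFun x := unitInterval.symm (OrderDual.ofDual x)
  left_inv x := by simp
  right_inv x := by simp
  map_rel_iff' := by
    intro a b
    simp

/-- A function on a connected linear order which is continuous and monotone, and strictly monotone
on `[x, y]`, makes `[x, y]` order isomorphic to the unit interval. -/
theorem nonempty_Icc_orderIso_unitInterval [TopologicalSpace M] [PreconnectedSpace M] {F : M → ℝ}
    (hF : Continuous F) (hmono : Monotone F) {x y : M} (hxy : x < y)
    (hstrict : StrictMonoOn F (Set.Icc x y)) : Nonempty (Set.Icc x y ≃o unitInterval) := by
  have hlt : F x < F y := hstrict ⟨le_rfl, hxy.le⟩ ⟨hxy.le, le_rfl⟩ hxy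
  have himage : F '' Set.Icc x y = Set.Icc (F x) (F y) := by
    refine Set.Subset.antisymm ?_ fun c hc => ?_
    · rintro _ ⟨z, hz, rfl⟩
      exact ⟨hmono hz.1, hmono hz.2⟩
    · obtain ⟨z, rfl⟩ := mem_range_of_exists_le_of_exists_ge hF ⟨x, hc.1⟩ ⟨y, hc.2⟩
      -- If the preimage `z` falls outside `[x, y]`, monotonicity makes the nearer endpoint a
      -- preimage too.
      rcases le_total z x with hzx | hzx
      · exact ⟨x, ⟨le_rfl, hxy.le⟩, le_antisymm hc.1 (hmono hzx)⟩
      rcases le_total y z with hyz | hyz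
      · exact ⟨y, ⟨hxy.le, le_rfl⟩, le_antisymm (hmono hyz) hc.2⟩
      exact ⟨z, ⟨hzx, hyz⟩, rfl⟩
  have hd : 0 < F y - F x := sub_pos.2 hlt
  let G : ℝ → unitInterval := fun c => Set.projIcc 0 1 zero_le_one ((c - F x) / (F y - F x))
  have hG : ∀ c ∈ Set.Icc (F x) (F y), (G c : ℝ) = (c - F x) / (F y - F x) := by
    intro c hc
    have h : (c - F x) / (F y - F x) ∈ Set.Icc (0 : ℝ) 1 :=
      ⟨div_nonneg (sub_nonneg.2 hc.1) hd.le, (div_le_one hd).2 (by linarith [hc.2])⟩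
    exact congrArg Subtype.val (Set.projIcc_of_mem zero_le_one h)
  have hmem : ∀ z ∈ Set.Icc x y, F z ∈ Set.Icc (F x) (F y) := fun z hz =>
    ⟨hmono hz.1, hmono hz.2⟩
  refine ⟨StrictMono.orderIsoOfSurjective (fun z : Set.Icc x y => G (F z)) ?_ ?_⟩
  · intro a b hab
    rw [← Subtype.coe_lt_coe, hG _ (hmem a a.2), hG _ (hmem b b.2), div_lt_div_iff_of_pos_right hd]
    exact sub_lt_sub_right (hstrict a.2 b.2 hab) _
  · intro t
    have ht : F x + t * (F y - F x) ∈ F '' Set.Icc x y := by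
      rw [himage]
      constructor <;> nlinarith [t.2.1, t.2.2]
    obtain ⟨z, hz, hzt⟩ := ht
    refine ⟨⟨z, hz⟩, Subtype.ext ?_⟩
    rw [hG _ (hmem z hz), hzt]
    field_simp
    ring

end Glue

/-! ### The compactified long ray -/

namespace LongRayPlusOne

/-- The index set `ω₁` of the long ray. -/
abbrev Index : Type := (ω₁ : Ordinal.{0}).ToType

theorem countable_Iic_index (α : Index) : (Set.Iic α).Countable := by
  have h : (Set.Iio α).Countable := by
    rw [← Cardinal.le_aleph0_iff_set_countable, ← Cardinal.lt_aleph_one_iff]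
    simpa using Cardinal.mk_Iio_lt α (by simp)
  rw [← Set.Iio_union_right]
  exact h.union (Set.countable_singleton α)

instance : Nonempty Index := by
  rw [Ordinal.nonempty_toType_iff]
  exact (Ordinal.omega_pos 1).ne'

/-- The point `t` of the copy of `[0, 1)` with index `α`. -/
def mk (α : Index) (t : Set.Ico (0 : ℝ) 1) : LongRayPlusOne :=
  WithTop.some (α := LongRay) (toLex (α, t))

noncomputable instance : OrderTop LongRayPlusOne :=
  inferInstanceAs (OrderTop (WithTop LongRay))

instance : DenselyOrdered LongRayPlusOne :=
  haveI : DenselyOrdered LongRay :=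
    inferInstanceAs (DenselyOrdered (Index ×ₗ Set.Ico (0 : ℝ) 1))
  haveI : NoMaxOrder LongRay :=
    inferInstanceAs (NoMaxOrder (Index ×ₗ Set.Ico (0 : ℝ) 1))
  inferInstanceAs (DenselyOrdered (WithTop LongRay))

theorem mk_le_mk {α β : Index} {t s : Set.Ico (0 : ℝ) 1} :
    mk α t ≤ mk β s ↔ α < β ∨ α = β ∧ t ≤ s :=
  WithTop.coe_le_coe.trans (Prod.Lex.le_iff (x := toLex (α, t)) (y := toLex (β, s)))

theorem mk_lt_mk {α β : Index} {t s : Set.Ico (0 : ℝ) 1} :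
    mk α t < mk β s ↔ α < β ∨ α = β ∧ t < s :=
  WithTop.coe_lt_coe.trans (Prod.Lex.lt_iff (x := toLex (α, t)) (y := toLex (β, s)))

theorem mk_lt_top (α : Index) (t : Set.Ico (0 : ℝ) 1) : mk α t < ⊤ :=
  WithTop.coe_lt_top (α := LongRay) _

theorem eq_top_or_mk (x : LongRayPlusOne) : x = ⊤ ∨ ∃ α t, x = mk α t := by
  induction x using WithTop.recTopCoe with
  | top => exact Or.inl rfl
  | coe p => exact Or.inr ⟨(ofLex p).1, (ofLex p).2, rfl⟩

/-- Well-ordering yields a least index occurring in `S`, and the infimum is taken within that copy.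
It stays there because `[0,1)` is closed on the left; a supremum could escape to the next copy. -/
theorem exists_isGLB (S : Set LongRayPlusOne) : ∃ z, IsGLB S z := by
  let A : Set Index := {α | ∃ t, mk α t ∈ S}
  rcases A.eq_empty_or_nonempty with hA | hA
  · refine ⟨⊤, fun x hx => ?_, fun x _ => le_top⟩
    rcases eq_top_or_mk x with rfl | ⟨α, t, rfl⟩
    · exact le_rfl
    · exact absurd (show α ∈ A from ⟨t, hx⟩) (hA ▸ Set.notMem_empty α)
  · obtain ⟨α, ⟨t, ht⟩, hmin⟩ := WellFounded.has_min (wellFounded_lt (α := Index)) A hA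
    let T : Set ℝ := {t | ∃ h : t ∈ Set.Ico (0 : ℝ) 1, mk α ⟨t, h⟩ ∈ S}
    have hT : T.Nonempty := ⟨t, t.2, ht⟩
    have hbdd : BddBelow T := ⟨0, fun s hs => hs.1.1⟩
    have h0 : sInf T ∈ Set.Ico (0 : ℝ) 1 :=
      ⟨le_csInf hT fun s hs => hs.1.1, (csInf_le hbdd ⟨t.2, ht⟩).trans_lt t.2.2⟩
    refine ⟨mk α ⟨sInf T, h0⟩, fun x hx => ?_, fun x hx => ?_⟩
    · rcases eq_top_or_mk x with rfl | ⟨β, s, rfl⟩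
      · exact le_top
      · rw [mk_le_mk]
        rcases (not_lt.1 (hmin β ⟨s, hx⟩)).lt_or_eq with h | rfl
        · exact Or.inl h
        · exact Or.inr ⟨rfl, csInf_le hbdd ⟨s.2, hx⟩⟩
    · rcases eq_top_or_mk x with rfl | ⟨β, s, rfl⟩
      · exact absurd (hx ht) (mk_lt_top α t).not_ge
      · rw [mk_le_mk]
        rcases mk_le_mk.1 (hx ht) with h | ⟨rfl, -⟩
        · exact Or.inl h
        · refine Or.inr ⟨rfl, le_csInf hT ?_⟩
          rintro r ⟨hr, hrS⟩
          rcases mk_le_mk.1 (hx hrS) with h | ⟨-, h⟩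
          · exact absurd h (lt_irrefl _)
          · exact h

/-- Completeness makes the order topology compact and, with density of the order, connected. -/
noncomputable instance : CompleteLinearOrder LongRayPlusOne :=
  letI : InfSet LongRayPlusOne := ⟨fun S => (exists_isGLB S).choose⟩
  letI c : CompleteLattice LongRayPlusOne :=
    { completeLatticeOfInf LongRayPlusOne fun S => (exists_isGLB S).choose_spec with
      top := ⊤
      le_top := fun _ => le_top }
  { (inferInstance : LinearOrder LongRayPlusOne), LinearOrder.toBiheytingAlgebra LongRayPlusOne with
    sSup := c.sSup
    sInf := c.sInf
    isLUB_sSup := c.isLUB_sSup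
    isGLB_sInf := c.isGLB_sInf }

/-- The coordinate of index `α`: the part of the copy of `[0, 1)` with index `α` that
lies below a point. -/
noncomputable def coord (α : Index) (x : LongRayPlusOne) : unitInterval :=
  WithTop.recTopCoe (C := fun _ => unitInterval) 1 (fun p : LongRay =>
    if (ofLex p).1 < α then 0 else if (ofLex p).1 = α then
      ⟨(ofLex p).2, (ofLex p).2.2.1, (ofLex p).2.2.2.le⟩ else 1) x

theorem coord_top (α : Index) : coord α ⊤ = 1 := rfl

theorem coord_mk_of_lt {α β : Index} (t) (h : β < α) : coord α (mk β t) = 0 :=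
  if_pos h

theorem coord_mk_self (α : Index) (t) : coord α (mk α t) = ⟨t, t.2.1, t.2.2.le⟩ :=
  (if_neg (lt_irrefl α)).trans (if_pos rfl)

theorem coord_mk_of_gt {α β : Index} (t) (h : α < β) : coord α (mk β t) = 1 :=
  (if_neg h.not_gt).trans (if_neg h.ne')

theorem monotone_coord (α : Index) : Monotone (coord α) := by
  intro x y hxy
  rcases eq_top_or_mk y with rfl | ⟨γ, s, rfl⟩
  · exact unitInterval.le_one'
  rcases eq_top_or_mk x with rfl | ⟨β, t, rfl⟩
  · exact absurd hxy (mk_lt_top γ s).not_ge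
  rcases lt_trichotomy β α with h | rfl | h
  · rw [coord_mk_of_lt t h]
    exact unitInterval.nonneg'
  · rcases mk_le_mk.1 hxy with h | ⟨rfl, h⟩
    · rw [coord_mk_of_gt s h]
      exact unitInterval.le_one'
    · rw [coord_mk_self, coord_mk_self]
      exact h
  · rw [coord_mk_of_gt s]
    · exact unitInterval.le_one'
    · rcases mk_le_mk.1 hxy with h' | ⟨rfl, -⟩
      · exact h.trans h'
      · exact h

theorem surjective_coord (α : Index) : Function.Surjective (coord α) := by
  intro t
  rcases t.2.2.lt_or_eq with h | h
  · exact ⟨mk α ⟨t, t.2.1, h⟩, coord_mk_self α _⟩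
  · exact ⟨⊤, Subtype.ext h.symm⟩

theorem continuous_coord (α : Index) : Continuous (coord α) :=
  (monotone_coord α).continuous_of_surjective (surjective_coord α)

/-- The index of `x` itself serves: there `x` has a value below 1, and later copies have value 1.
The bound by `δ` leaves only countably many coordinates to consider below `mk δ t`. -/
theorem exists_coord_lt {δ : Index} {t : Set.Ico (0 : ℝ) 1} {x y : LongRayPlusOne} (hxy : x < y)
    (hx : x ≤ mk δ t) : ∃ α ≤ δ, coord α x < coord α y := by
  rcases eq_top_or_mk x with rfl | ⟨β, s, rfl⟩
  · exact absurd hxy not_top_lt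
  have hs : (⟨s, s.2.1, s.2.2.le⟩ : unitInterval) < 1 := s.2.2
  refine ⟨β, (mk_le_mk.1 hx).elim le_of_lt fun h => h.1.le, ?_⟩
  rw [coord_mk_self]
  rcases eq_top_or_mk y with rfl | ⟨γ, r, rfl⟩
  · rwa [coord_top]
  rcases mk_lt_mk.1 hxy with h | ⟨rfl, h⟩
  · rwa [coord_mk_of_gt r h]
  · rw [coord_mk_self]
    exact h

theorem injective_coord : Function.Injective fun x α => coord α x := by
  have key : ∀ x y : LongRayPlusOne, x < y → (fun α => coord α x) ≠ fun α => coord α y := by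
    intro x y hxy h
    rcases eq_top_or_mk x with rfl | ⟨β, s, rfl⟩
    · exact absurd hxy not_top_lt
    obtain ⟨α, -, hα⟩ := exists_coord_lt hxy le_rfl
    exact hα.ne (congrFun h α)
  intro x y h
  by_contra hne
  rcases lt_or_gt_of_ne hne with h' | h'
  · exact key x y h' h
  · exact key y x h' h.symm

theorem countable_coord_ne_zero {x : LongRayPlusOne} (hx : x ≠ ⊤) :
    {α | coord α x ≠ 0}.Countable := by
  rcases eq_top_or_mk x with rfl | ⟨β, s, rfl⟩
  · exact absurd rfl hx
  refine (countable_Iic_index β).mono fun α hα => ?_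
  by_contra h
  exact hα (coord_mk_of_lt s (not_le.1 h))

/-- With `y` in copy `δ`, the countably many coordinates of index at most `δ` separate the points of
`[x, y]`. Their sum with summable positive weights is continuous, monotone, and strictly monotone on
`[x, y]`. -/
theorem nonempty_Icc_orderIso {x y : LongRayPlusOne} (hxy : x < y) (hy : y ≠ ⊤) :
    Nonempty (Set.Icc x y ≃o unitInterval) := by
  rcases eq_top_or_mk y with rfl | ⟨δ, s, rfl⟩
  · exact absurd rfl hy
  have : Countable (Set.Iic δ) := (countable_Iic_index δ).to_subtype
  let _ : Encodable (Set.Iic δ) := Encodable.ofCountable _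
  let w : Set.Iic δ → ℝ := fun α => (1 / 2) ^ Encodable.encode α
  have hw : Summable w := summable_geometric_two_encode
  have hw0 : ∀ α, 0 < w α := fun α => by positivity
  let f : Set.Iic δ → LongRayPlusOne → ℝ := fun α x => w α * coord α x
  have hf : ∀ α x, ‖f α x‖ ≤ w α := by
    intro α x
    have h : 0 ≤ f α x := mul_nonneg (hw0 α).le (coord α x).2.1
    rw [Real.norm_of_nonneg h]
    exact mul_le_of_le_one_right (hw0 α).le (coord α x).2.2
  have hsum : ∀ x, Summable fun α => f α x := fun x => hw.of_norm_bounded fun α => hf α x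
  have hle : ∀ {x y}, x ≤ y → ∀ α, f α x ≤ f α y := fun h α =>
    mul_le_mul_of_nonneg_left (monotone_coord α h) (hw0 α).le
  refine nonempty_Icc_orderIso_unitInterval (F := fun x => ∑' α, f α x) ?_ ?_ hxy ?_
  · refine continuous_tsum (fun α => ?_) hw hf
    exact continuous_const.mul (continuous_subtype_val.comp (continuous_coord α))
  · exact fun x y h => (hsum x).tsum_le_tsum (hle h) (hsum y)
  · intro a ha b hb hab
    obtain ⟨α, hα, h⟩ := exists_coord_lt hab ha.2
    exact Summable.tsum_lt_tsum (i := ⟨α, hα⟩) (hle hab.le)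
      (mul_lt_mul_of_pos_left h (hw0 ⟨α, hα⟩)) (hsum a) (hsum b)

theorem exists_between_top {x : LongRayPlusOne} (hx : x ≠ ⊤) : ∃ y, x < y ∧ y ≠ ⊤ :=
  let ⟨y, hxy, hy⟩ := exists_between (lt_top_iff_ne_top.2 hx)
  ⟨y, hxy, hy.ne⟩

theorem bot_ne_top : (⊥ : LongRayPlusOne) ≠ ⊤ := fun h =>
  (mk_lt_top (Classical.arbitrary Index) ⟨0, by simp⟩).not_ge (h ▸ bot_le)

/-- Every upper part of the compactified long ray is isomorphic to it. -/
theorem nonempty_Ici_orderIso {x : LongRayPlusOne} (hx : x ≠ ⊤) :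
    Nonempty (Set.Ici x ≃o LongRayPlusOne) := by
  obtain ⟨y, hxy, hy⟩ := exists_between_top hx
  obtain ⟨f⟩ := nonempty_Icc_orderIso hxy hy
  obtain ⟨g⟩ := nonempty_Icc_orderIso (bot_le.trans_lt hxy) hy
  -- Both `[x, y]` and `[⊥, y]` are copies of `[0,1]`; above `y` nothing changes.
  refine nonempty_orderIso_of_Iic_of_Ici (y := (⟨y, hxy.le⟩ : Set.Ici x)) (z := y)
    ((iicIciOrderIso _).trans (f.trans (g.symm.trans ?_))) (iciIciOrderIso _)
  exact OrderIso.setCongr _ _ (by simp [Set.Icc_bot])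

theorem dense_compl_top : Dense ({⊤}ᶜ : Set LongRayPlusOne) := by
  intro x
  have h : closure (Set.Iio (⊤ : LongRayPlusOne)) = Set.Iic ⊤ :=
    closure_Iio' ⟨⊥, lt_top_iff_ne_top.2 bot_ne_top⟩
  have hx : x ∈ closure (Set.Iio (⊤ : LongRayPlusOne)) := h ▸ Set.mem_Iic.2 le_top
  exact closure_mono (fun y hy => ne_of_lt hy) hx

end LongRayPlusOne

/-! ### Long intervals -/

/-- The point `m` cuts `K` into a reversed compactified long ray and a compactified long ray. -/
def IsLongCenter {K : Type*} [LinearOrder K] (m : K) : Prop :=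
  Nonempty (Set.Ici m ≃o LongRayPlusOne) ∧ Nonempty (Set.Iic m ≃o LongRayPlusOneᵒᵈ)

namespace IsLongCenter

variable {K : Type*} [LinearOrder K] {m : K}

theorem dual (h : IsLongCenter m) : IsLongCenter (OrderDual.toDual m) := by
  obtain ⟨⟨f⟩, ⟨g⟩⟩ := h
  exact ⟨⟨(iciDualOrderIso m).trans (g.dual.trans (OrderIso.dualDual _).symm)⟩,
    ⟨(iicDualOrderIso m).trans f.dual⟩⟩

theorem nonempty_orderIso {L : Type*} [LinearOrder L] {n : L} (h : IsLongCenter m)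
    (h' : IsLongCenter n) : Nonempty (K ≃o L) := by
  obtain ⟨⟨f⟩, ⟨g⟩⟩ := h
  obtain ⟨⟨f'⟩, ⟨g'⟩⟩ := h'
  exact nonempty_orderIso_of_Iic_of_Ici (g.trans g'.symm) (f.trans f'.symm)

/-- For `p ≥ m` this is an upper part of a long ray. For `p < m`, the piece `[p, m]` is a copy of
`[0,1]` put before a long ray, and an initial piece `[⊥, z]` of the ray absorbs it. -/
theorem nonempty_Ici_orderIso (h : IsLongCenter m) {p : K} (hmax : ¬ IsMax p) (hmin : ¬ IsMin p) :
    Nonempty (Set.Ici p ≃o LongRayPlusOne) := by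
  obtain ⟨⟨f⟩, ⟨g⟩⟩ := h
  rcases le_or_gt m p with hp | hp
  · have hne : f ⟨p, hp⟩ ≠ ⊤ := by
      intro htop
      refine hmax fun q hq => ?_
      have h1 : f ⟨q, hp.trans hq⟩ ≤ f ⟨p, hp⟩ := htop ▸ le_top
      exact f.le_iff_le.1 h1
    obtain ⟨k⟩ := LongRayPlusOne.nonempty_Ici_orderIso hne
    exact ⟨(iciIciOrderIso ⟨p, hp⟩).symm.trans ((f.restrictIci _).trans k)⟩
  · obtain ⟨z, hz, hz'⟩ := LongRayPlusOne.exists_between_top LongRayPlusOne.bot_ne_top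
    obtain ⟨i⟩ := LongRayPlusOne.nonempty_Icc_orderIso hz hz'
    obtain ⟨j⟩ := LongRayPlusOne.nonempty_Ici_orderIso hz'
    set x : LongRayPlusOne := OrderDual.ofDual (g ⟨p, hp.le⟩) with hx
    have hbot : ⊥ < x := by
      rw [bot_lt_iff_ne_bot]
      intro h0
      refine hp.not_ge ?_
      have h1 : g ⟨m, le_rfl⟩ ≤ g ⟨p, hp.le⟩ := by
        have h2 : OrderDual.ofDual (g ⟨p, hp.le⟩) ≤ OrderDual.ofDual (g ⟨m, le_rfl⟩) := by
          rw [← hx, h0]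
          exact bot_le
        exact h2
      exact g.le_iff_le.1 h1
    have htop : x ≠ ⊤ := by
      intro h0
      refine hmin fun q hq => ?_
      have h1 : g ⟨p, hp.le⟩ ≤ g ⟨q, hq.trans hp.le⟩ := by
        have h2 : OrderDual.ofDual (g ⟨q, hq.trans hp.le⟩) ≤ OrderDual.ofDual (g ⟨p, hp.le⟩) := by
          rw [← hx, h0]
          exact le_top
        exact h2
      exact g.le_iff_le.1 h1
    obtain ⟨k⟩ := LongRayPlusOne.nonempty_Icc_orderIso hbot htop
    -- Under `g`, `[p, m]` is the reverse of `[⊥, x]`, and `[0,1]` is its own reverse.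
    have e₁ : Set.Icc p m ≃o unitInterval := by
      refine (iciIicOrderIso (⟨p, hp.le⟩ : Set.Iic m)).symm.trans ((g.restrictIci _).trans
        ((iciDualOrderIso x).trans ?_))
      refine OrderIso.trans (OrderIso.dual ?_) unitIntervalReversal.symm
      exact (OrderIso.setCongr _ _ (by simp [Set.Icc_bot])).trans k
    refine nonempty_orderIso_of_Iic_of_Ici (y := (⟨m, hp.le⟩ : Set.Ici p)) (z := z)
      ((iicIciOrderIso _).trans (e₁.trans (i.symm.trans ?_)))
      ((iciIciOrderIso _).trans (f.trans j.symm))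
    exact OrderIso.setCongr _ _ (by simp [Set.Icc_bot])

theorem nonempty_Iic_orderIso (h : IsLongCenter m) {p : K} (hmax : ¬ IsMax p) (hmin : ¬ IsMin p) :
    Nonempty (Set.Iic p ≃o LongRayPlusOneᵒᵈ) := by
  obtain ⟨f⟩ := h.dual.nonempty_Ici_orderIso (p := OrderDual.toDual p)
    (fun h => hmin h) (fun h => hmax h)
  exact ⟨(OrderIso.dualDual _).trans ((iciDualOrderIso p).symm.trans f).dual⟩

theorem isLongInterval (h : IsLongCenter m) : IsLongInterval K := by
  obtain ⟨⟨f⟩, ⟨g⟩⟩ := id h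
  set a : K := (g.symm (OrderDual.toDual ⊤)).1 with ha
  set b : K := (f.symm ⊤).1 with hb
  have hbm : ∀ x, x ≤ b := by
    intro x
    rcases le_total x m with hx | hx
    · exact hx.trans (f.symm ⊤).2
    · have h1 : (⟨x, hx⟩ : Set.Ici m) ≤ f.symm ⊤ := (f.le_symm_apply).2 le_top
      exact h1
  have ham : ∀ x, a ≤ x := by
    intro x
    rcases le_total m x with hx | hx
    · exact le_trans (g.symm (OrderDual.toDual ⊤)).2 hx
    · have h1 : g.symm (OrderDual.toDual ⊤) ≤ (⟨x, hx⟩ : Set.Iic m) :=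
        (g.symm_apply_le).2 (show OrderDual.ofDual (g ⟨x, hx⟩) ≤ ⊤ from le_top)
      exact h1
  have hmb : m < b := by
    refine lt_of_le_of_ne (hbm m) fun h0 => LongRayPlusOne.bot_ne_top ?_
    have h1 : f.symm ⊤ = f.symm ⊥ := Subtype.ext (le_antisymm
      (by rw [← hb, ← h0]; exact (f.symm ⊥).2) (hbm _))
    exact (f.symm.injective h1).symm
  have hma : a < m := by
    refine lt_of_le_of_ne (ham m) fun h0 => LongRayPlusOne.bot_ne_top ?_
    have h1 : g.symm (OrderDual.toDual ⊤) = g.symm (OrderDual.toDual ⊥) := Subtype.ext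
      (le_antisymm (ham _) (by rw [← ha, h0]; exact (g.symm _).2))
    exact (OrderDual.toDual.injective (g.symm.injective h1)).symm
  refine ⟨a, b, fun x => ⟨ham x, hbm x⟩, ⟨m, hma, hmb⟩, fun p hp => ?_⟩
  have hmax : ¬ IsMax p := not_isMax_of_lt hp.2
  have hmin : ¬ IsMin p := not_isMin_of_lt hp.1
  obtain ⟨k⟩ := h.nonempty_Ici_orderIso hmax hmin
  obtain ⟨l⟩ := h.nonempty_Iic_orderIso hmax hmin
  refine ⟨⟨OrderIso.trans (OrderIso.setCongr _ _ ?_) k⟩,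
    ⟨OrderIso.trans (OrderIso.setCongr _ _ ?_) l⟩⟩
  · ext x
    simp [hbm x]
  · ext x
    simp [ham x]

end IsLongCenter

theorem IsLongInterval.exists_isLongCenter {K : Type*} [LinearOrder K] (h : IsLongInterval K) :
    ∃ m : K, IsLongCenter m := by
  obtain ⟨a, b, hab, ⟨m, hm⟩, h⟩ := h
  obtain ⟨⟨f⟩, ⟨g⟩⟩ := h m hm
  refine ⟨m, ⟨OrderIso.trans (OrderIso.setCongr _ _ ?_) f⟩,
    ⟨OrderIso.trans (OrderIso.setCongr _ _ ?_) g⟩⟩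
  · ext x
    simp [(hab x).2]
  · ext x
    simp [(hab x).1]

/-- The common point of the two rays of the long interval. -/
noncomputable def LongInterval.center : LongInterval :=
  toLex (Sum.inr (⊥ : LongRayPlusOne))

theorem LongInterval.isLongCenter_center : IsLongCenter LongInterval.center := by
  constructor
  · let F : LongRayPlusOne → Set.Ici LongInterval.center := fun x =>
      ⟨toLex (Sum.inr x), Sum.Lex.inr_le_inr_iff.2 bot_le⟩
    have hF : StrictMono F := fun x y h => Sum.Lex.inr_lt_inr_iff.2 h
    refine ⟨(hF.orderIsoOfSurjective F ?_).symm⟩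
    rintro ⟨x, hx⟩
    rcases x with x | x
    · exact absurd hx Sum.Lex.not_inr_le_inl
    · exact ⟨x, rfl⟩
  · classical
    -- The least element was left out of the left ray, so it is sent to the center.
    let F : LongRayPlusOneᵒᵈ → Set.Iic LongInterval.center := fun x =>
      if h : IsMin (OrderDual.ofDual x) then ⟨LongInterval.center, Set.mem_Iic.2 le_rfl⟩ else
        ⟨toLex (Sum.inl (OrderDual.toDual ⟨OrderDual.ofDual x, h⟩)),
          Set.mem_Iic.2 (le_of_lt (Sum.Lex.inl_lt_inr _ _))⟩
    have hF : StrictMono F := by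
      intro x y h
      have hx : ¬ IsMin (OrderDual.ofDual x) := not_isMin_of_lt (show OrderDual.ofDual y < _ from h)
      by_cases hy : IsMin (OrderDual.ofDual y)
      · simp only [F, dif_neg hx, dif_pos hy]
        exact Sum.Lex.inl_lt_inr _ _
      · simp only [F, dif_neg hx, dif_neg hy]
        exact Sum.Lex.inl_lt_inl_iff.2 h
    refine ⟨(hF.orderIsoOfSurjective F ?_).symm⟩
    rintro ⟨x, hx⟩
    rcases x with x | x
    · exact ⟨OrderDual.toDual (OrderDual.ofDual x).1, dif_neg (OrderDual.ofDual x).2⟩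
    · refine ⟨OrderDual.toDual ⊥, (dif_pos isMin_bot).trans (Subtype.ext ?_)⟩
      have h : x ≤ ⊥ := Sum.Lex.inr_le_inr_iff.1 hx
      exact congrArg (fun y : LongRayPlusOne => (toLex (Sum.inr y) : LongInterval))
        (le_bot_iff.1 h).symm

/-! ### Valdivia compacta -/

/-- A compact space with an injective map into a cube which sends the points of a dense set into
the `Σ`-product is Valdivia compact. -/
theorem isValdiviaCompact_of_dense {X Γ : Type u} [TopologicalSpace X] [CompactSpace X]
    {e : X → Γ → unitInterval} (he : Continuous e) (hinj : Function.Injective e) {D : Set X}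
    (hD : Dense D) (hsig : ∀ x ∈ D, {γ | e x γ ≠ 0}.Countable) : IsValdiviaCompact X := by
  have hemb := he.isClosedEmbedding hinj
  refine ⟨Γ, e, hemb.isEmbedding, Set.Subset.antisymm ?_ ?_⟩
  · have h : e '' D ⊆ Set.range e ∩ sigmaProduct Γ := by
      rintro _ ⟨x, hx, rfl⟩
      exact ⟨⟨x, rfl⟩, hsig x hx⟩
    calc Set.range e = e '' closure D := by rw [hD.closure_eq, Set.image_univ]
      _ ⊆ closure (e '' D) := image_closure_subset_closure_image he
      _ ⊆ _ := closure_mono h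
  · exact hemb.isClosed_range.closure_subset_iff.2 Set.inter_subset_left

theorem LongRayPlusOne.isValdiviaCompact : IsValdiviaCompact LongRayPlusOne :=
  isValdiviaCompact_of_dense (e := fun x α => LongRayPlusOne.coord α x)
    (continuous_pi LongRayPlusOne.continuous_coord) LongRayPlusOne.injective_coord
    LongRayPlusOne.dense_compl_top fun _ hx => LongRayPlusOne.countable_coord_ne_zero hx

/-- Taking the maximum or minimum with `m` retracts `K` onto each half, and the other half collapses
to the least point of that ray, whose support is countable. Countable support thus holds unless one
of the two projections is `⊤`. -/
theorem IsLongCenter.isValdiviaCompact {K : Type} [LinearOrder K] [TopologicalSpace K]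
    [OrderTopology K] {m : K} (h : IsLongCenter m) : IsValdiviaCompact K := by
  obtain ⟨⟨f⟩, ⟨g⟩⟩ := h
  let F : Set.Ici m ≃ₜ LongRayPlusOne := f.toHomeomorph
  let G : Set.Iic m ≃ₜ LongRayPlusOneᵒᵈ := g.toHomeomorph
  let r : K → LongRayPlusOne := fun x => F ⟨max x m, le_max_right _ _⟩
  let l : K → LongRayPlusOne := fun x => OrderDual.ofDual (G ⟨min x m, min_le_right _ _⟩)
  have hr : Continuous r :=
    F.continuous.comp ((continuous_id.max continuous_const).subtype_mk _)
  have hl : Continuous l :=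
    continuous_ofDual.comp (G.continuous.comp ((continuous_id.min continuous_const).subtype_mk _))
  let i : LongRayPlusOne → K := fun x => F.symm x
  let j : LongRayPlusOne → K := fun x => G.symm (OrderDual.toDual x)
  have hi : Continuous i := continuous_subtype_val.comp F.symm.continuous
  have hj : Continuous j :=
    continuous_subtype_val.comp (G.symm.continuous.comp continuous_toDual)
  have hcover : Set.range i ∪ Set.range j = Set.univ := by
    refine Set.eq_univ_of_forall fun x => ?_
    rcases le_total m x with hx | hx
    · exact Or.inl ⟨F ⟨x, hx⟩, by simp [i]⟩
    · exact Or.inr ⟨OrderDual.ofDual (G ⟨x, hx⟩), by simp [j]⟩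
  have hri : ∀ x, r (i x) = x := by
    intro x
    have : (⟨max (i x) m, le_max_right _ _⟩ : Set.Ici m) = F.symm x :=
      Subtype.ext (max_eq_left (F.symm x).2)
    simp only [r, this, Homeomorph.apply_symm_apply]
  have hlj : ∀ x, l (j x) = x := by
    intro x
    have : (⟨min (j x) m, min_le_right _ _⟩ : Set.Iic m) = G.symm (OrderDual.toDual x) :=
      Subtype.ext (min_eq_left (G.symm (OrderDual.toDual x)).2)
    simp only [l, this, Homeomorph.apply_symm_apply, OrderDual.ofDual_toDual]
  have hrm : ∀ x ≤ m, r x = ⊥ := by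
    intro x hx
    have : (⟨max x m, le_max_right _ _⟩ : Set.Ici m) = ⟨m, le_rfl⟩ := Subtype.ext (max_eq_right hx)
    simp only [r, this]
    exact map_bot f
  have hlm : ∀ x, m ≤ x → l x = ⊥ := by
    intro x hx
    have : (⟨min x m, min_le_right _ _⟩ : Set.Iic m) = ⟨m, le_rfl⟩ := Subtype.ext (min_eq_right hx)
    simp only [l, this]
    exact congrArg OrderDual.ofDual (map_top g)
  have : CompactSpace K := ⟨hcover ▸ (isCompact_range hi).union (isCompact_range hj)⟩
  let e : K → LongRayPlusOne.Index ⊕ LongRayPlusOne.Index → unitInterval := fun x =>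
    Sum.elim (fun α => LongRayPlusOne.coord α (r x)) (fun α => LongRayPlusOne.coord α (l x))
  have he : Continuous e := by
    refine continuous_pi fun γ => ?_
    rcases γ with α | α
    · exact (LongRayPlusOne.continuous_coord α).comp hr
    · exact (LongRayPlusOne.continuous_coord α).comp hl
  have hinj : Function.Injective e := by
    intro x y hxy
    have h1 : r x = r y :=
      LongRayPlusOne.injective_coord (funext fun α => congrFun hxy (Sum.inl α))
    have h2 : l x = l y :=
      LongRayPlusOne.injective_coord (funext fun α => congrFun hxy (Sum.inr α))
    have h3 : max x m = max y m := congrArg Subtype.val (F.injective h1)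
    have h4 : min x m = min y m :=
      congrArg Subtype.val (G.injective (OrderDual.ofDual.injective h2))
    -- In a distributive lattice, the meet and join with `m` determine a point.
    exact eq_of_inf_eq_sup_eq h4 h3
  refine isValdiviaCompact_of_dense he hinj (D := {x | r x ≠ ⊤ ∧ l x ≠ ⊤}) ?_ ?_
  · have him : i '' {⊤}ᶜ ⊆ {x | r x ≠ ⊤ ∧ l x ≠ ⊤} := by
      rintro _ ⟨x, hx, rfl⟩
      exact ⟨(hri x).symm ▸ hx, (hlm _ (F.symm x).2).symm ▸ LongRayPlusOne.bot_ne_top⟩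
    have hjm : j '' {⊤}ᶜ ⊆ {x | r x ≠ ⊤ ∧ l x ≠ ⊤} := by
      rintro _ ⟨x, hx, rfl⟩
      exact ⟨(hrm _ (G.symm (OrderDual.toDual x)).2).symm ▸ LongRayPlusOne.bot_ne_top,
        (hlj x).symm ▸ hx⟩
    intro x
    rcases hcover.symm ▸ Set.mem_univ x with ⟨y, rfl⟩ | ⟨y, rfl⟩
    · exact closure_mono him (image_closure_subset_closure_image hi
        ⟨y, LongRayPlusOne.dense_compl_top y, rfl⟩)
    · exact closure_mono hjm (image_closure_subset_closure_image hj
        ⟨y, LongRayPlusOne.dense_compl_top y, rfl⟩)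
  · rintro x ⟨hx, hx'⟩
    refine (((LongRayPlusOne.countable_coord_ne_zero hx).image Sum.inl).union
      ((LongRayPlusOne.countable_coord_ne_zero hx').image Sum.inr)).mono ?_
    rintro (α | α) h
    · exact Or.inl ⟨α, h, rfl⟩
    · exact Or.inr ⟨α, h, rfl⟩

/-- The compactified long ray is Valdivia compact; the long interval is, up to order isomorphism,
the only linearly ordered set with its defining property, and it is Valdivia compact. -/
theorem mainTheorem11 :
    IsValdiviaCompact LongRayPlusOne ∧
    (IsLongInterval LongInterval ∧
      ∀ (K : Type u) [LinearOrder K], IsLongInterval K → Nonempty (K ≃o LongInterval)) ∧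
    IsValdiviaCompact LongInterval := by
  refine ⟨LongRayPlusOne.isValdiviaCompact,
    ⟨LongInterval.isLongCenter_center.isLongInterval, fun K _ hK => ?_⟩,
    LongInterval.isLongCenter_center.isValdiviaCompact⟩
  obtain ⟨m, hm⟩ := hK.exists_isLongCenter
  exact hm.nonempty_orderIso LongInterval.isLongCenter_center
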